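/- For a finite group $G$, let the generator exponent of $G$ be $$\mathrm{ge}(G):=\min_S \operatorname{lcm}\{\operatorname{ord}(x)\mid x\in S\},$$ where $S$ ranges over all generating subsets of $G$. For a finite solvable group $G$, consider all series $(N_i,G_i)_{i=1,\dots,s}$, $s\ge 0$, of subgroups of $G$ such that, with $G_0:=G$, one has $G_s=\{1\}$ and, for every $i=1,\dots,s$, $N_i$ is a nilpotent normal subgroup of $G_{i-1}$ and $G_i$ is a proper subgroup of $G_{i-1}$ with $N_iG_i=G_{i-1}$. Put $$r(G):=\min \operatorname{lcm}(\exp(N_1),\dots,\exp(N_s)),$$ where the minimum is taken over all such series, and $\exp$ denotes the exponent of a group (the empty $\operatorname{lcm}$ is $1$). Corollary 4.6. Let $G$ be a finite nilpotent group of nilpotency class $c$, and assume that $p\ge c$, where $p$ is the smallest prime divisor of $|G|$ (no condition if $G$ is trivial). Then $r(G)=\mathrm{ge}(G)$. -/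

import Mathlib

open scoped Pointwise

/-- The generator exponent `ge(G)` of a finite group `G`: the minimum, over all generating subsets
`S` of `G`, of the least common multiple of the orders of the elements of `S`. -/
noncomputable def generatorExponent (G : Type*) [Group G] : ℕ :=
  sInf {n : ℕ | ∃ S : Finset G, Subgroup.closure (S : Set G) = ⊤ ∧ n = S.lcm orderOf}

/-- For subgroups `K`, `N`, `U` of `G`: `U` is a proper subgroup of `K` with `N U = K`
(the product of sets). When `N` is a normal subgroup of `K`, this says that `U` is a partial
complement of `N` in `K`. -/
structure IsPartialComplement {G : Type*} [Group G] (K N U : Subgroup G) : Prop where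
  lt : U < K
  mul_eq : (N : Set G) * (U : Set G) = (K : Set G)

/-- `(N 0, U 1), …, (N (s - 1), U s)` is a series in `G = U 0` ending in `U s = 1` such that, for
each `i < s`, `N i` is a nilpotent normal subgroup of `U i` and `U (i + 1)` is a partial complement
of `N i` in `U i`. The subgroups `U i` are strictly decreasing, so `s` is the least index with
`U s = 1`. Values `N i` with `s ≤ i` and `U i` with `s < i` are irrelevant. -/
structure IsPartialComplementSeries {G : Type*} [Group G]
    (s : ℕ) (N U : ℕ → Subgroup G) : Prop where
  zero : U 0 = ⊤
  last : U s = ⊥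
  le : ∀ i < s, N i ≤ U i
  normal : ∀ i < s, ((N i).subgroupOf (U i)).Normal
  nilpotent : ∀ i < s, Group.IsNilpotent (N i)
  partialComplement : ∀ i < s, IsPartialComplement (U i) (N i) (U (i + 1))

/-- The constant `r(G)` of a finite solvable group `G`: the minimum, over all series as above, of
the least common multiple of the exponents of the groups `N i`, `i < s` (equal to `1` for the empty
series of the trivial group). -/
noncomputable def shafarevichConstant (G : Type*) [Group G] : ℕ :=
  sInf {n : ℕ | ∃ (s : ℕ) (N U : ℕ → Subgroup G), IsPartialComplementSeries s N U ∧
    n = (Finset.range s).lcm fun i => Monoid.exponent (N i)}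

/-- For a finite group the minimum defining `ge(G)` is attained. -/
theorem generatorExponent_mem (G : Type*) [Group G] [Finite G] :
    ∃ S : Finset G, Subgroup.closure (S : Set G) = ⊤ ∧ generatorExponent G = S.lcm orderOf := by
  have := Fintype.ofFinite G
  exact Nat.sInf_mem (s := {n : ℕ | ∃ S : Finset G, Subgroup.closure (S : Set G) = ⊤ ∧
    n = S.lcm orderOf}) ⟨_, Finset.univ, by simp, rfl⟩

/-- For a nilpotent group the minimum defining `r(G)` is attained. -/
theorem shafarevichConstant_mem (G : Type*) [Group G] [Group.IsNilpotent G] :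
    ∃ (s : ℕ) (N U : ℕ → Subgroup G), IsPartialComplementSeries s N U ∧
      shafarevichConstant G = (Finset.range s).lcm fun i => Monoid.exponent (N i) := by
  refine Nat.sInf_mem (s := {n : ℕ | ∃ (s : ℕ) (N U : ℕ → Subgroup G),
    IsPartialComplementSeries s N U ∧
      n = (Finset.range s).lcm fun i => Monoid.exponent (N i)}) ?_
  cases subsingleton_or_nontrivial G with
  | inl h =>
    exact ⟨_, 0, fun _ => ⊤, fun _ => ⊤, ⟨rfl, Subsingleton.elim _ _, by simp, by simp, by simp,
      by simp⟩, rfl⟩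
  | inr h =>
    refine ⟨_, 1, fun _ => ⊤, fun i => if i = 0 then ⊤ else ⊥, ⟨by simp, by simp, ?_, ?_, ?_, ?_⟩,
      rfl⟩
    · intro i hi
      obtain rfl : i = 0 := by omega
      simp
    · intro i hi
      rw [Subgroup.top_subgroupOf]
      infer_instance
    · intro i hi
      infer_instance
    · intro i hi
      obtain rfl : i = 0 := by omega
      refine ⟨?_, ?_⟩
      · simp
      · simp

/-! The inequality ge(G) ≤ r(G) holds because the groups N_i of any series generate G. For the
converse, let S be a generating set attaining ge(G) and n the lcm of its orders; n is coprime to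
every i < c. Split off the elements of S one at a time, each through its normal closure in the
subgroup generated by it and the remaining ones. It remains to see that the normal closure of an
n-torsion element t has exponent dividing n (`pow_eq_one_of_mem_normalClosure_singleton`).

Conjugates of t commute modulo γ_3, so for c ≥ 2 this normal closure has class at most c - 1; this
saved step is why p = c is allowed. By `pow_eq_one_of_closure_eq_top`, a group of class at most d
generated by n-torsion is killed by n if n is coprime to 1, …, d. The proof is by induction on d:
first γ_2 is killed by n, and then `mul_pow_of_coprime_of_nilpotent` makes x ↦ x ^ n multiplicative.
The latter is a Hall–Petresco argument: (xy)^(-k) x^k y^k is a product of powers a_j ^ (k choose j)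
with a_j ∈ γ_j and j ≥ 2, and n divides n choose j. -/

open scoped commutatorElement

/-! ### Polynomial sequences in a filtered group -/

/-- The binomial sequences `k ↦ a ^ (k choose j)` with `a ∈ H (m + j)`, closed under products,
inverses and commutators; `m` is the level of the sequence in the induced filtration. -/
inductive PolynomialSequence {G : Type*} [Group G] (H : ℕ → Subgroup G) : ℕ → (ℕ → G) → Prop
  | binomial (m j : ℕ) (a : G) (ha : a ∈ H (m + j)) :
      PolynomialSequence H m fun k => a ^ k.choose j
  | mul {m : ℕ} {f g : ℕ → G} (hf : PolynomialSequence H m f) (hg : PolynomialSequence H m g) :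
      PolynomialSequence H m (f * g)
  | inv {m : ℕ} {f : ℕ → G} (hf : PolynomialSequence H m f) : PolynomialSequence H m f⁻¹
  | commutator {i j : ℕ} {f g : ℕ → G} (hf : PolynomialSequence H i f)
      (hg : PolynomialSequence H j g) : PolynomialSequence H (i + j) ⁅f, g⁆
  | of_succ {m : ℕ} {f : ℕ → G} (hf : PolynomialSequence H (m + 1) f) : PolynomialSequence H m f

/-- The left difference `k ↦ f (k + 1) * (f k)⁻¹` of a sequence. -/
def leftDifference {G : Type*} [Group G] (f : ℕ → G) : ℕ → G := fun k => f (k + 1) * (f k)⁻¹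

section Filtration

variable {G : Type*} [Group G] {H : ℕ → Subgroup G}

namespace PolynomialSequence

theorem one (m : ℕ) : PolynomialSequence H m 1 := by
  have h := binomial (H := H) m 0 1 (one_mem _)
  simp only [one_pow] at h
  exact h

theorem mono {m m' : ℕ} (h : m ≤ m') {f : ℕ → G} (hf : PolynomialSequence H m' f) :
    PolynomialSequence H m f := by
  induction h with
  | refl => exact hf
  | step _ ih => exact ih hf.of_succ

theorem commutator_mem {i j m : ℕ} (h : m ≤ i + j) {f g : ℕ → G} (hf : PolynomialSequence H i f)
    (hg : PolynomialSequence H j g) : PolynomialSequence H m ⁅f, g⁆ :=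
  mono h (hf.commutator hg)

theorem conj {i m : ℕ} {f g : ℕ → G} (hf : PolynomialSequence H i f)
    (hg : PolynomialSequence H m g) : PolynomialSequence H m (f * g * f⁻¹) := by
  have h : f * g * f⁻¹ = ⁅f, g⁆ * g := by simp [commutatorElement_def]
  rw [h]
  exact (commutator_mem (by omega) hf hg).mul hg

theorem apply_mem (hanti : Antitone H) (hcomm : ∀ i j, ⁅H i, H j⁆ ≤ H (i + j))
    {m : ℕ} {f : ℕ → G} (hf : PolynomialSequence H m f) (k : ℕ) : f k ∈ H m := by
  induction hf with
  | binomial m j a ha => exact pow_mem (hanti (Nat.le_add_right m j) ha) _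
  | mul _ _ hf hg => exact mul_mem hf hg
  | inv _ hf => exact inv_mem hf
  | commutator _ _ hf hg => exact hcomm _ _ (Subgroup.commutator_mem_commutator hf hg)
  | of_succ _ hf => exact hanti (Nat.le_succ _) hf

/-- Pascal's rule handles binomial sequences; products and inverses obey a Leibniz rule up to
conjugation, which preserves the level. -/
theorem leftDifference {m : ℕ} {f : ℕ → G} (hf : PolynomialSequence H m f) :
    PolynomialSequence H (m + 1) (leftDifference f) := by
  induction hf with
  | binomial m j a ha =>
    cases j with
    | zero =>
      have : _root_.leftDifference (fun k => a ^ k.choose 0) = 1 := by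
        ext k; simp [_root_.leftDifference]
      rw [this]
      exact one _
    | succ j =>
      have : _root_.leftDifference (fun k => a ^ k.choose (j + 1)) = fun k => a ^ k.choose j := by
        ext k; simp [_root_.leftDifference, Nat.choose_succ_succ, pow_add]
      rw [this]
      exact binomial _ _ _ (by rwa [show m + 1 + j = m + (j + 1) by omega])
  | @mul m f g hf hg hu hv =>
    have : _root_.leftDifference (f * g) =
        _root_.leftDifference f * (f * _root_.leftDifference g * f⁻¹) := by
      ext k; simp [_root_.leftDifference, mul_assoc]
    rw [this]
    exact hu.mul (hf.conj hv)
  | @inv m f hf hu =>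
    have : _root_.leftDifference f⁻¹ = f⁻¹ * (_root_.leftDifference f)⁻¹ * f⁻¹⁻¹ := by
      ext k; simp [_root_.leftDifference]
    rw [this]
    exact hf.inv.conj hu.inv
  | @commutator i j f g hf hg hu hv =>
    set u := _root_.leftDifference f with hu'
    set v := _root_.leftDifference g with hv'
    -- Up to conjugation each factor has level at least i + j + 1: `⁅f, v⁆` and `⁅u, v * g⁆` involve
    -- a difference, and `u * v` has level at least 1, which raises that of `⁅f, g⁆`.
    have : _root_.leftDifference ⁅f, g⁆ =
        (u * ⁅f, v⁆ * u⁻¹) * (⁅u * v, ⁅f, g⁆⁆ * (⁅f, g⁆ * ⁅u, v * g⁆ * ⁅f, g⁆⁻¹)) := by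
      ext k
      have hf1 : f (k + 1) = u k * f k := by simp [hu', _root_.leftDifference]
      have hg1 : g (k + 1) = v k * g k := by simp [hv', _root_.leftDifference]
      simp only [_root_.leftDifference, Pi.mul_apply, Pi.inv_apply, commutatorElement_def, hf1, hg1]
      group
    rw [this]
    have hc := hf.commutator hg
    refine (hu.conj (commutator_mem (by omega) hf hv)).mul (.mul ?_ (hc.conj ?_))
    · exact commutator_mem (i := 1) (by omega) ((mono (by omega) hu).mul (mono (by omega) hv)) hc
    · exact commutator_mem (by omega) hu ((mono (by omega) hv).mul hg)
  | of_succ _ hu => exact hu.of_succ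

theorem iterate_leftDifference {f : ℕ → G} (m : ℕ) (hf : PolynomialSequence H 0 f) :
    PolynomialSequence H m (_root_.leftDifference^[m] f) := by
  induction m with
  | zero => exact hf
  | succ m ih => rw [Function.iterate_succ_apply']; exact ih.leftDifference

end PolynomialSequence

theorem iterate_leftDifference_zero {m : ℕ} {f : ℕ → G} (hf : ∀ k < m, f k = 1) :
    leftDifference^[m] f 0 = f m := by
  induction m generalizing f with
  | zero => rfl
  | succ m ih =>
    rw [Function.iterate_succ_apply, ih fun k hk => ?_]
    · simp [leftDifference, hf m]
    · simp [leftDifference, hf k (by omega), hf (k + 1) (by omega)]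

theorem eq_one_of_iterate_leftDifference {m : ℕ} {f : ℕ → G} (hf : ∀ k < m, f k = 1)
    (hD : ∀ k, leftDifference^[m] f k = 1) (k : ℕ) : f k = 1 := by
  induction m generalizing f k with
  | zero => exact hD k
  | succ m ih =>
    have hd := ih (f := leftDifference f)
      (fun k hk => by simp [leftDifference, hf k (by omega), hf (k + 1) (by omega)]) hD
    induction k with
    | zero => exact hf 0 (by omega)
    | succ k ihk => simpa [leftDifference, ihk] using hd k

/-- A polynomial sequence vanishing at `0, …, m - 1` is a product of binomial sequences
of degrees `m, …, c`; it vanishes at `n` if these binomial sequences do. -/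
theorem PolynomialSequence.apply_eq_one (hanti : Antitone H)
    (hcomm : ∀ i j, ⁅H i, H j⁆ ≤ H (i + j)) {c n : ℕ} (hbot : H (c + 1) = ⊥) (r m : ℕ)
    (hr : m + r = c + 1) (hpow : ∀ j, m ≤ j → j ≤ c → ∀ a ∈ H j, a ^ n.choose j = 1)
    {f : ℕ → G} (hf : PolynomialSequence H 0 f) (hf0 : ∀ k < m, f k = 1) : f n = 1 := by
  induction r generalizing m f with
  | zero =>
    obtain rfl : m = c + 1 := hr
    refine eq_one_of_iterate_leftDifference hf0 (fun k => ?_) n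
    have h := (hf.iterate_leftDifference (c + 1)).apply_mem hanti hcomm k
    rwa [hbot, Subgroup.mem_bot] at h
  | succ r ih =>
    have ha : f m ∈ H m := by
      rw [← iterate_leftDifference_zero hf0]
      exact (hf.iterate_leftDifference m).apply_mem hanti hcomm 0
    -- Dividing by this sequence removes the value at m and, since k choose m = 0 for k < m, keeps
    -- the earlier zeros.
    have hb : PolynomialSequence H 0 fun k => f m ^ k.choose m :=
      .binomial 0 m _ (by rwa [zero_add])
    have h := ih (m + 1) (by omega) (fun j hj => hpow j (by omega)) (hf.mul hb.inv) fun k hk => by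
      rcases Nat.lt_succ_iff_lt_or_eq.mp hk with hk | rfl
      · simp [hf0 k hk, Nat.choose_eq_zero_of_lt hk]
      · simp
    simpa [hpow m le_rfl (by omega) _ ha] using h

end Filtration

/-! ### Torsion in nilpotent groups -/

section NilpotentTorsion

open Subgroup

/-- The three subgroups lemma, applied in the quotient by N. -/
theorem commutator_commutator_le_of_rotate {G : Type*} [Group G] {A B C N : Subgroup G} [N.Normal]
    (h1 : ⁅⁅B, C⁆, A⁆ ≤ N) (h2 : ⁅⁅C, A⁆, B⁆ ≤ N) : ⁅⁅A, B⁆, C⁆ ≤ N := by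
  rw [← QuotientGroup.ker_mk' N, ← Subgroup.map_eq_bot_iff] at h1 h2 ⊢
  simp only [Subgroup.map_commutator] at h1 h2 ⊢
  exact commutator_commutator_eq_bot_of_rotate h1 h2

theorem commutator_lowerCentralSeries_le (G : Type*) [Group G] (i j : ℕ) :
    ⁅(⊤ : Subgroup G).lowerCentralSeries i, (⊤ : Subgroup G).lowerCentralSeries j⁆ ≤
      (⊤ : Subgroup G).lowerCentralSeries (i + j + 1) := by
  induction j generalizing i with
  | zero => exact le_rfl
  | succ j ih =>
    rw [commutator_comm, Subgroup.lowerCentralSeries_succ]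
    refine commutator_commutator_le_of_rotate ?_ ?_
    · rw [commutator_comm ⊤, ← Subgroup.lowerCentralSeries_succ]
      exact (ih (i + 1)).trans_eq (by congr 1; omega)
    · exact (commutator_mono (ih i) le_rfl).trans_eq
        (by rw [← Subgroup.lowerCentralSeries_succ]; congr 1)

/-- The commutator inequality for the lower central filtration indexed so that its terms of
index `0` and `1` are the whole group. -/
theorem commutator_lowerCentralSeries_pred_le (G : Type*) [Group G] (i j : ℕ) :
    ⁅(⊤ : Subgroup G).lowerCentralSeries (i - 1), (⊤ : Subgroup G).lowerCentralSeries (j - 1)⁆ ≤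
      (⊤ : Subgroup G).lowerCentralSeries (i + j - 1) := by
  rcases i with _ | i
  · simpa using commutator_le_right _ ((⊤ : Subgroup G).lowerCentralSeries (j - 1))
  · rcases j with _ | j
    · simpa using commutator_le_left ((⊤ : Subgroup G).lowerCentralSeries i) _
    · exact (commutator_lowerCentralSeries_le G i j).trans_eq (by congr 1; omega)

/-- By absorption, i (n choose i) = n (n - 1 choose i - 1). -/
theorem dvd_choose_of_coprime {n i : ℕ} (hi : i ≠ 0) (h : n.Coprime i) : n ∣ n.choose i := by
  obtain ⟨i, rfl⟩ := Nat.exists_eq_succ_of_ne_zero hi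
  rcases n with _ | n
  · simp
  · exact h.dvd_of_dvd_mul_right ⟨_, (Nat.add_one_mul_choose_eq n i).symm⟩

/-- In a group of class at most `c` whose commutator subgroup is killed by an `n` coprime to
`1, …, c`, the map `x ↦ x ^ n` is multiplicative. -/
theorem mul_pow_of_coprime_of_nilpotent {G : Type*} [Group G] {c n : ℕ}
    (hc : (⊤ : Subgroup G).lowerCentralSeries c = ⊥) (hn : ∀ i, 1 ≤ i → i ≤ c → n.Coprime i)
    (hG : ∀ a ∈ _root_.commutator G, a ^ n = 1) (x y : G) : (x * y) ^ n = x ^ n * y ^ n := by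
  -- Truncated subtraction gives H 0 = H 1 = G, so k ↦ z ^ k is a polynomial sequence for every z.
  let H : ℕ → Subgroup G := fun m => (⊤ : Subgroup G).lowerCentralSeries (m - 1)
  have hanti : Antitone H := fun a b hab => Subgroup.lowerCentralSeries_antitone _ (by omega)
  have hpow (z : G) : PolynomialSequence H 0 fun k => z ^ k := by
    simpa using PolynomialSequence.binomial (H := H) 0 1 z (by simp [H])
  -- The sequence (xy)^(-k) x^k y^k is trivial at k = 0 and k = 1, so only degrees j ≥ 2 occur,
  -- where H j lies in the commutator subgroup.
  have hf := (((hpow (x * y)).inv.mul (hpow x)).mul (hpow y))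
  have h := hf.apply_eq_one (n := n) hanti (commutator_lowerCentralSeries_pred_le G) hc (c - 1) 2
  rcases c with _ | c
  · have : Subsingleton G := by
      rw [← Subgroup.subsingleton_iff, ← subsingleton_iff_bot_eq_top]
      exact hc.symm
    exact Subsingleton.elim _ _
  · have h := h (by omega) (fun j hj hjc a ha => ?_) fun k hk => ?_
    · simp only [Pi.mul_apply, Pi.inv_apply, mul_assoc] at h
      exact (inv_mul_eq_one.mp h)
    · obtain ⟨d, hd⟩ := dvd_choose_of_coprime (by omega) (hn j (by omega) hjc)
      rw [hd, pow_mul, hG a, one_pow]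
      rw [← top_lowerCentralSeries_one]
      exact Subgroup.lowerCentralSeries_antitone _ (show 1 ≤ j - 1 by omega) ha
    · interval_cases k <;> simp [mul_assoc]

/-- The lower central series of K is one step ahead from its first commutator on, and later
commutators preserve this lead. -/
theorem lowerCentralSeries_eq_bot_of_commutator_le {G : Type*} [Group G] {K : Subgroup G} {c : ℕ}
    (hK : ⁅K, K⁆ ≤ (⊤ : Subgroup G).lowerCentralSeries 2) (hc0 : 1 ≤ c)
    (hc : (⊤ : Subgroup G).lowerCentralSeries (c + 1) = ⊥) : K.lowerCentralSeries c = ⊥ := by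
  have h (i : ℕ) : K.lowerCentralSeries (i + 1) ≤ (⊤ : Subgroup G).lowerCentralSeries (i + 2) := by
    induction i with
    | zero => exact hK
    | succ i ih => exact commutator_mono ih le_top
  obtain ⟨c, rfl⟩ := Nat.exists_eq_add_of_le' hc0
  exact eq_bot_iff.mpr ((h c).trans hc.le)

/-- For conjugates a and b = k a k⁻¹ of t one has [a, b] = [a, [k, a]], so the generators commute
modulo γ_3. -/
theorem commutator_normalClosure_singleton_le {G : Type*} [Group G] (t : G) :
    ⁅normalClosure {t}, normalClosure {t}⁆ ≤ (⊤ : Subgroup G).lowerCentralSeries 2 := by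
  set N := (⊤ : Subgroup G).lowerCentralSeries 2 with hN
  rw [← QuotientGroup.ker_mk' N, ← Subgroup.map_eq_bot_iff, map_commutator,
    commutator_self_eq_bot_iff, normalClosure, MonoidHom.map_closure]
  refine Subgroup.isMulCommutative_closure ?_
  rintro _ ⟨a, ha, rfl⟩ _ ⟨b, hb, rfl⟩
  simp only [Group.conjugatesOfSet, Set.mem_singleton_iff, Set.iUnion_iUnion_eq_left,
    conjugatesOf, Set.mem_ofPred_eq] at ha hb
  obtain ⟨k, hk⟩ := isConj_iff.mp (ha.symm.trans hb)
  rw [← commutatorElement_eq_one_iff_mul_comm, ← map_commutatorElement, ← MonoidHom.mem_ker,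
    QuotientGroup.ker_mk']
  have : ⁅a, b⁆ = ⁅a, ⁅k, a⁆⁆ := by
    rw [← hk, commutatorElement_def, commutatorElement_def, commutatorElement_def]
    group
  rw [this, hN, Subgroup.lowerCentralSeries_succ, commutator_comm]
  exact commutator_mem_commutator (mem_top _)
    (commutator_mem_commutator (mem_top k) (mem_top a))

theorem pow_eq_one_of_mem_conjugatesOfSet {G : Type*} [Group G] {n : ℕ} {X : Set G}
    (hX : ∀ x ∈ X, x ^ n = 1) : ∀ x ∈ Group.conjugatesOfSet X, x ^ n = 1 := by
  intro x hx
  obtain ⟨a, ha, hax⟩ := Group.mem_conjugatesOfSet_iff.mp hx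
  obtain ⟨g, rfl⟩ := isConj_iff.mp hax
  rw [conj_pow, hX a ha, mul_one, mul_inv_cancel]

universe u

/-- If all groups of class at most `c` generated by elements killed by `n` are killed by `n`, then
the same holds for subgroups with lower central series computed in the ambient group. -/
theorem pow_eq_one_of_mem_closure_of_forall {n c : ℕ}
    (h : ∀ (G : Type u) [Group G], (⊤ : Subgroup G).lowerCentralSeries c = ⊥ →
      closure {x : G | x ^ n = 1} = ⊤ → ∀ g : G, g ^ n = 1)
    {G : Type u} [Group G] {X : Set G} (hX : ∀ x ∈ X, x ^ n = 1)
    (hc : (closure X).lowerCentralSeries c = ⊥) : ∀ g ∈ closure X, g ^ n = 1 := by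
  intro g hg
  have := h (closure X) ?_ ?_ ⟨g, hg⟩
  · simpa [Subtype.ext_iff] using this
  · rw [← map_subtype_inj, Subgroup.map_bot, top_subtype_lowerCentralSeries, hc]
  · rw [eq_top_iff, ← closure_closure_coe_preimage]
    exact closure_mono fun x hx => Subtype.ext (by simpa using hX x hx)

/-- A group of class at most `c` generated by elements killed by `n`, where `n` is coprime to
`1, …, c`, is killed by `n`. -/
theorem pow_eq_one_of_closure_eq_top {n : ℕ} (c : ℕ) (hn : ∀ i, 1 ≤ i → i ≤ c → n.Coprime i)
    (G : Type u) [Group G] (hc : (⊤ : Subgroup G).lowerCentralSeries c = ⊥)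
    (hG : closure {x : G | x ^ n = 1} = ⊤) (g : G) : g ^ n = 1 := by
  induction c generalizing G with
  | zero =>
    have hg : g ∈ (⊤ : Subgroup G).lowerCentralSeries 0 := mem_top g
    rw [hc, mem_bot] at hg
    rw [hg, one_pow]
  | succ c ih =>
    have hG' : ∀ a ∈ _root_.commutator G, a ^ n = 1 := by
      rcases Nat.eq_zero_or_pos c with rfl | hc0
      · intro a ha
        rw [← top_lowerCentralSeries_one, hc, mem_bot] at ha
        rw [ha, one_pow]
      · have ih' {X : Set G} := pow_eq_one_of_mem_closure_of_forall (G := G) (X := X)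
          (fun G _ h1 h2 g => ih (fun i h1 h2 => hn i h1 (by omega)) G h1 h2 g)
        let X : Set G := {z | ∃ x : G, x ^ n = 1 ∧ ∃ y : G, y ^ n = 1 ∧ ⁅x, y⁆ = z}
        have hX : ∀ z ∈ X, z ^ n = 1 := by
          rintro _ ⟨x, hx, y, -, rfl⟩
          -- The commutator lies in the normal closure of x, which is generated by n-torsion and has
          -- smaller class.
          refine ih' (X := Group.conjugatesOfSet {x}) ?_ ?_ _ ?_
          · exact pow_eq_one_of_mem_conjugatesOfSet (by simpa using hx)
          · exact lowerCentralSeries_eq_bot_of_commutator_le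
              (commutator_normalClosure_singleton_le x) hc0 hc
          · change ⁅x, y⁆ ∈ normalClosure {x}
            have hxm : x ∈ normalClosure {x} := subset_normalClosure rfl
            rw [commutatorElement_def, mul_assoc, mul_assoc, ← mul_assoc y]
            exact mul_mem hxm (normalClosure_normal.conj_mem _ (inv_mem hxm) y)
        have hle : normalClosure X ≤ _root_.commutator G := by
          refine normalClosure_le_normal ?_
          rintro _ ⟨x, -, y, -, rfl⟩
          exact commutator_mem_commutator (mem_top x) (mem_top y)
        -- Modulo the normal closure of X the torsion generators of G commute, so the quotient is
        -- abelian.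
        have hge : _root_.commutator G ≤ normalClosure X := by
          rw [_root_.commutator_def, ← hG]
          rw [← QuotientGroup.ker_mk' (normalClosure X), ← Subgroup.map_eq_bot_iff, map_commutator,
            commutator_self_eq_bot_iff, MonoidHom.map_closure]
          refine Subgroup.isMulCommutative_closure ?_
          rintro _ ⟨x, hx, rfl⟩ _ ⟨y, hy, rfl⟩
          rw [← commutatorElement_eq_one_iff_mul_comm, ← map_commutatorElement,
            ← MonoidHom.mem_ker, QuotientGroup.ker_mk']
          exact subset_normalClosure ⟨x, hx, y, hy, rfl⟩
        intro a ha
        refine ih' (pow_eq_one_of_mem_conjugatesOfSet hX) ?_ a (hge ha)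
        refine lowerCentralSeries_eq_bot_of_commutator_le ?_ hc0 hc
        exact (commutator_mono hle le_top)
    have hg : g ∈ closure {x : G | x ^ n = 1} := hG ▸ mem_top g
    induction hg using closure_induction with
    | mem x hx => exact hx
    | one => exact one_pow n
    | mul x y _ _ hx hy => rw [mul_pow_of_coprime_of_nilpotent hc hn hG', hx, hy, one_mul]
    | inv x _ hx => rw [inv_pow, hx, inv_one]

/-- In a nilpotent group of class at most `c`, the normal closure of an `n`-torsion element has
exponent dividing `n` as soon as `n` is coprime to all `i` with `1 ≤ i < c`. -/
theorem pow_eq_one_of_mem_normalClosure_singleton {G : Type u} [Group G] {c n : ℕ}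
    (hc : (⊤ : Subgroup G).lowerCentralSeries c = ⊥)
    (hn : ∀ i, 1 ≤ i → i < c → n.Coprime i) {t : G} (ht : t ^ n = 1) :
    ∀ g ∈ normalClosure {t}, g ^ n = 1 := by
  -- The maximum covers c ≤ 1, where the lead of one step is unavailable; coprimality to 1 is
  -- automatic.
  have hc2 : (⊤ : Subgroup G).lowerCentralSeries (max 1 (c - 1) + 1) = ⊥ :=
    eq_bot_iff.mpr ((Subgroup.lowerCentralSeries_antitone _ (by omega)).trans hc.le)
  refine pow_eq_one_of_mem_closure_of_forall
    (pow_eq_one_of_closure_eq_top (max 1 (c - 1)) fun i h1 hi => ?_)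
    (pow_eq_one_of_mem_conjugatesOfSet (by simpa using ht))
    (lowerCentralSeries_eq_bot_of_commutator_le (commutator_normalClosure_singleton_le t)
      (le_max_left _ _) hc2)
  rcases Nat.lt_or_ge i c with h | h
  · exact hn i h1 h
  · obtain rfl : i = 1 := by omega
    exact Nat.coprime_one_right n

end NilpotentTorsion

/-! ### Comparison of the two invariants -/

open Subgroup in
/-- Splitting off the normal closures of the elements of a generating set one by one. -/
theorem exists_partialComplementSeries {G : Type*} [Group G] [Group.IsNilpotent G] {n : ℕ}
    (hN : ∀ t : G, t ^ n = 1 → ∀ g ∈ normalClosure {t}, g ^ n = 1) (S : Finset G)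
    (hS : ∀ x ∈ S, x ^ n = 1) :
    ∃ (s : ℕ) (N U : ℕ → Subgroup G), U 0 = closure (S : Set G) ∧ U s = ⊥ ∧
      (∀ i < s, N i ≤ U i) ∧ (∀ i < s, ((N i).subgroupOf (U i)).Normal) ∧
      (∀ i < s, IsPartialComplement (U i) (N i) (U (i + 1))) ∧
      ∀ i < s, Monoid.exponent (N i) ∣ n := by
  classical
  induction S using Finset.induction_on with
  | empty => exact ⟨0, fun _ => ⊥, fun _ => ⊥, by simp⟩
  | insert x S _ ih =>
    obtain ⟨s, N, U, h0, hs, hle, hnor, hpc, hexp⟩ :=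
      ih fun y hy => hS y (Finset.mem_insert_of_mem hy)
    set K := closure ((insert x S : Finset G) : Set G) with hK
    have hUK : U 0 ≤ K := by
      rw [h0]; exact closure_mono (by simp)
    rcases hUK.eq_or_lt with h | h
    -- A redundant x is skipped, since partial complements must be proper.
    · exact ⟨s, N, U, h, hs, hle, hnor, hpc, hexp⟩
    have hxK : x ∈ K := subset_closure (by simp)
    -- The closure is taken in K, as normality is required only there; it is contained in the normal
    -- closure in G, which bounds its exponent.
    let M : Subgroup K := normalClosure {⟨x, hxK⟩}
    have hMK : M.map K.subtype ≤ K := map_subtype_le M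
    have hMn : (M.map K.subtype).subgroupOf K = M :=
      comap_map_eq_self_of_injective K.subtype_injective M
    have hsup : K ≤ M.map K.subtype ⊔ U 0 := by
      refine (closure_le _).mpr fun y hy => ?_
      rcases Finset.mem_insert.mp hy with rfl | hy
      · exact mem_sup_left ⟨⟨y, hxK⟩, subset_normalClosure rfl, rfl⟩
      · exact mem_sup_right (h0 ▸ subset_closure hy)
    refine ⟨s + 1, fun i => Nat.casesOn i (M.map K.subtype) N, fun i => Nat.casesOn i K U, rfl, hs,
      ?_, ?_, ?_, ?_⟩
    · rintro (_ | i) hi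
      · exact hMK
      · exact hle i (by omega)
    · rintro (_ | i) hi
      · change ((M.map K.subtype).subgroupOf K).Normal
        rw [hMn]
        exact normalClosure_normal
      · exact hnor i (by omega)
    · rintro (_ | i) hi
      · refine ⟨h, ?_⟩
        change ((M.map K.subtype : Subgroup G) : Set G) * (U 0 : Set G) = (K : Set G)
        have hnorm : U 0 ≤ normalizer (M.map K.subtype : Set G) := by
          refine hUK.trans ?_
          rw [← normal_subgroupOf_iff_le_normalizer hMK, hMn]
          exact normalClosure_normal
        rw [← Subgroup.coe_mul_of_right_le_normalizer_left _ _ hnorm]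
        exact congrArg _ (le_antisymm (sup_le hMK hUK) hsup)
      · exact hpc i (by omega)
    · rintro (_ | i) hi
      · refine Monoid.exponent_dvd_of_forall_pow_eq_one fun g => Subtype.ext ?_
        refine hN x (hS x (Finset.mem_insert_self x S)) _ ?_
        have : M.map K.subtype ≤ normalClosure {x} := by
          rw [map_le_iff_le_comap]
          refine normalClosure_le_normal (Set.singleton_subset_iff.mpr ?_)
          exact subset_normalClosure (Set.mem_singleton x)
        exact this g.2
      · exact hexp i (by omega)

theorem shafarevichConstant_le_generatorExponent (G : Type*) [Group G] [Finite G]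
    [Group.IsNilpotent G] (hc : Group.nilpotencyClass G ≤ (Nat.card G).minFac) :
    shafarevichConstant G ≤ generatorExponent G := by
  obtain ⟨S, hS, hn⟩ := generatorExponent_mem G
  rw [hn]
  set n := S.lcm orderOf with hn'
  have hn0 : 0 < n := by
    rw [Nat.pos_iff_ne_zero, hn', Ne, Finset.lcm_eq_zero_iff]
    rintro ⟨x, -, hx⟩
    exact (orderOf_pos x).ne' hx
  have hndvd : n ∣ Nat.card G := Finset.lcm_dvd fun x _ => orderOf_dvd_natCard x
  -- A common prime factor of n and i would divide |G| and be at most i < c, below the smallest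
  -- prime divisor of |G|.
  have hcop : ∀ i, 1 ≤ i → i < Group.nilpotencyClass G → n.Coprime i := by
    intro i hi hic
    refine Nat.coprime_of_dvd fun q hq hqn hqi => ?_
    have h1 := Nat.minFac_le_of_dvd hq.two_le (hqn.trans hndvd)
    have h2 := Nat.le_of_dvd hi hqi
    omega
  obtain ⟨s, N, U, h0, hs, hle, hnor, hpc, hexp⟩ := exists_partialComplementSeries (n := n)
    (fun t ht => pow_eq_one_of_mem_normalClosure_singleton
      Subgroup.lowerCentralSeries_nilpotencyClass hcop ht) S
    fun x hx => orderOf_dvd_iff_pow_eq_one.mp (Finset.dvd_lcm hx)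
  have hle : shafarevichConstant G ≤ (Finset.range s).lcm fun i => Monoid.exponent (N i) :=
    Nat.sInf_le ⟨s, N, U, ⟨h0.trans hS, hs, hle, hnor, fun i _ => inferInstance, hpc⟩, rfl⟩
  exact hle.trans (Nat.le_of_dvd hn0 (Finset.lcm_dvd fun i hi => hexp i (Finset.mem_range.mp hi)))

/-- Since U i = N i · U (i + 1), induction upwards from U s = 1 places every U i in the closure. -/
theorem IsPartialComplementSeries.closure_iUnion_eq_top {G : Type*} [Group G] {s : ℕ}
    {N U : ℕ → Subgroup G} (h : IsPartialComplementSeries s N U) :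
    Subgroup.closure (⋃ i < s, (N i : Set G)) = ⊤ := by
  have key (j : ℕ) (hj : j ≤ s) : U (s - j) ≤ Subgroup.closure (⋃ i < s, (N i : Set G)) := by
    induction j with
    | zero => simp [h.last]
    | succ j ih =>
      have hlt : s - (j + 1) < s := by omega
      intro g hg
      rw [← SetLike.mem_coe, ← (h.partialComplement _ hlt).mul_eq] at hg
      obtain ⟨a, ha, b, hb, rfl⟩ := hg
      refine mul_mem (Subgroup.subset_closure (Set.mem_biUnion hlt ha)) (ih (by omega) ?_)
      rwa [show s - (j + 1) + 1 = s - j by omega] at hb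
  rw [eq_top_iff, ← h.zero]
  simpa using key s le_rfl

theorem generatorExponent_le_shafarevichConstant (G : Type*) [Group G] [Finite G]
    [Group.IsNilpotent G] : generatorExponent G ≤ shafarevichConstant G := by
  obtain ⟨s, N, U, h, hr⟩ := shafarevichConstant_mem G
  have hfin : (⋃ i < s, (N i : Set G)).Finite := Set.toFinite _
  have hle : generatorExponent G ≤ hfin.toFinset.lcm orderOf :=
    Nat.sInf_le ⟨hfin.toFinset, by simpa using h.closure_iUnion_eq_top, rfl⟩
  rw [hr]
  refine hle.trans (Nat.le_of_dvd (Nat.pos_of_ne_zero ?_) (Finset.lcm_dvd fun x hx => ?_))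
  · rw [Ne, Finset.lcm_eq_zero_iff]
    rintro ⟨i, -, hi⟩
    exact Monoid.exponent_ne_zero_of_finite hi
  · simp only [Set.Finite.mem_toFinset, Set.mem_iUnion] at hx
    obtain ⟨i, hi, hx⟩ := hx
    have h1 := Monoid.order_dvd_exponent (⟨x, hx⟩ : N i)
    rw [Subgroup.orderOf_mk] at h1
    exact h1.trans (Finset.dvd_lcm (f := fun i => Monoid.exponent (N i)) (Finset.mem_range.mpr hi))

theorem corollary4p6 (G : Type*) [Group G] [Finite G] [Group.IsNilpotent G]
    (hc : Group.nilpotencyClass G ≤ (Nat.card G).minFac) :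
    shafarevichConstant G = generatorExponent G :=
  le_antisymm (shafarevichConstant_le_generatorExponent G hc)
    (generatorExponent_le_shafarevichConstant G)
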